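/- Let $b_0,b_1,\dots$ be a basis of $\mathbb Q[x]$ such that, for every $j$, $b_0,\dots,b_j$ span the polynomials of degree at most $j$. Let $a_0,\dots,a_N\in\mathbb Q$ and $r,d\in\mathbb N$, and put $s=(r+1)(d+1)$. Let $M=(A\odot B_d\,|\,A\odot B_{d-1}\,|\cdots|\,A\odot B_0)$, where $A=(a_{n+i})$ and $B_j=(b_j(n))$ for $0\le n\le N-r$, $0\le i\le r$, and $\odot$ is the entrywise product; denominators are cleared by multiplying with some nonzero integer, so that $M$ is an integer matrix with $s$ columns. A vector $w=(c_{i,j})\in\mathbb Z^{s}$ corresponds to the recurrence $\sum_{i=0}^r P_i(n)\,a_{n+i}=0$ with $P_i=\sum_{j=0}^d c_{i,j}b_j$; a recurrence matches the data if it holds for $n=0,\dots,N-r$. Consider the following algorithm. 1. Choose a prime $p$, put $q=p$, and compute a row-reduced basis $V$ of $\ker M$ mod $p$. If $V=\emptyset$, return "no recurrence found". 2. Repeat: choose a new prime $p$ and compute a row-reduced basis $W$ of $\ker M$ mod $p$; merge $V$ and $W$ by componentwise Chinese remaindering modulo $pq$ (if they have different sizes, the shorter one is filled up with zero vectors), call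 the result $V$ and replace $q$ by $pq$; let $w$ be the first vector of an LLL-reduced basis (with parameter $3/4$) of the lattice generated by $V\cup\{qe_1,\dots,qe_s\}$; until the recurrence corresponding to $w$ matches the data. Return this recurrence. Call a prime $p$ unlucky if $\ker_{\mathbb Z}M=\{0\}$ but $\ker M$ mod $p$ is nontrivial. Then the following holds. (a) Correctness: for all choices of primes and of reduced bases, if the algorithm returns the recurrence corresponding to $w$, then this recurrence is nontrivial, has order at most $r$ and polynomial coefficients of degree at most $d$, and matches the data, and $\|w\|\le 2^{s}\|x\|$ for every nonzero $x\in\mathbb Z^{s}$ whose recurrence matches the data. If it returns "no recurrence found", then no nontrivial recurrence of order at most $r$ with polynomial coefficients in $\mathbb Q[x]$ of degree at most $d$ matches the data. (b) Termination: there are only finitely many unlucky primes. If the first prime is not unlucky (in particular, for every first prime if $\ker_{\mathbb Z}M\ne\{0\}$), then, for all choices of the later primes and of the reduced bases, every step of the algorithm can be carried out and the algorithm returns a result after finitely many steps. (c) Each time LLL is applied, the lattice consists of all $w\in\mathbb Z^{s}$ with $Mw\equiv 0$ mod $q$. (d) For every nonzero $x\in\ker_{\mathbb Z}M$ there is a $Q$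 such that, whenever LLL is applied with a modulus $q\ge Q$, all lattice vectors outside $\ker_{\mathbb Z}M$ are more than $2^{s}$ times longer than $x$, and the first vector of every LLL-reduced basis of the lattice belongs to $\ker_{\mathbb Z}M$. -/

import Mathlib

namespace Guess

/-! ### Recurrences and the linear system -/

/-- The matrix `A` with entries `A n i = a_{n+i}`, for `n = 0, …, N - r` and `i = 0, …, r`. -/
def matA {N : ℕ} (a : Fin (N + 1) → ℚ) (r : ℕ) : Matrix (Fin (N + 1 - r)) (Fin (r + 1)) ℚ :=
  fun n i => a ⟨n.val + i.val, by omega⟩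

/-- The matrix `B_j`, all of whose columns are `(b_j(0), …, b_j(N - r))`. -/
noncomputable def matB (N : ℕ) (b : ℕ → Polynomial ℚ) (r j : ℕ) :
    Matrix (Fin (N + 1 - r)) (Fin (r + 1)) ℚ :=
  fun n _ => (b j).eval (n.val : ℚ)

/-- The block matrix `(A ⊙ B_d | A ⊙ B_{d-1} | ⋯ | A ⊙ B_0)`: column `k` is column number
`k mod (r+1)` of the block number `k div (r+1)`. -/
noncomputable def guessMatrix {N : ℕ} (a : Fin (N + 1) → ℚ) (b : ℕ → Polynomial ℚ) (r d : ℕ) :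
    Matrix (Fin (N + 1 - r)) (Fin ((d + 1) * (r + 1))) ℚ :=
  fun n k => Matrix.hadamard (matA a r) (matB N b r (d - k.divNat.val)) n k.modNat

/-- The recurrence `∑ i, P i (n) * a_{n+i} = 0` of order at most `r` is given by its polynomial
coefficients `P 0, …, P r`.  It matches the data `a_0, …, a_N` if it holds for all `n` for which
`a_n, …, a_{n+r}` are among the data. -/
def Matches {N : ℕ} (a : Fin (N + 1) → ℚ) {r : ℕ} (P : Fin (r + 1) → Polynomial ℚ) : Prop :=
  ∀ n : Fin (N + 1 - r),
    ∑ i : Fin (r + 1), (P i).eval (n.val : ℚ) * a ⟨n.val + i.val, by omega⟩ = 0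

/-- The recurrence that corresponds to a vector of coefficients: the coefficient of `b_j` in the
polynomial that is multiplied with `a_{n+i}` is the entry at column `i` of the block of `b_j`,
which is the block number `d - j`. -/
noncomputable def recurrenceOf (b : ℕ → Polynomial ℚ) (r d : ℕ)
    (w : Fin ((d + 1) * (r + 1)) → ℤ) : Fin (r + 1) → Polynomial ℚ :=
  fun i => ∑ j : Fin (d + 1), (w (finProdFinEquiv (Fin.rev j, i)) : ℚ) • b j.val

/-! ### Euclidean length and LLL-reduced bases -/

/-- An integer vector as an element of Euclidean space. -/
noncomputable def toEuc {n : ℕ} (v : Fin n → ℤ) : EuclideanSpace ℝ (Fin n) :=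
  WithLp.toLp 2 (fun i => (v i : ℝ))

/-- The Euclidean length of an integer vector. -/
noncomputable def len {n : ℕ} (v : Fin n → ℤ) : ℝ := ‖toEuc v‖

/-- The Gram–Schmidt orthogonalization (without normalization) of a family of integer vectors. -/
noncomputable def gs {n k : ℕ} (v : Fin k → Fin n → ℤ) : Fin k → EuclideanSpace ℝ (Fin n) :=
  InnerProductSpace.gramSchmidt ℝ (fun i => toEuc (v i))

/-- The Gram–Schmidt coefficients. -/
noncomputable def gsCoeff {n k : ℕ} (v : Fin k → Fin n → ℤ) (i j : Fin k) : ℝ :=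
  inner ℝ (toEuc (v i)) (gs v j) / ‖gs v j‖ ^ 2

/-- LLL-reduced families, with the classical parameter `3/4`: linearly independent, size-reduced,
and satisfying the Lovász condition. -/
structure IsLLLReduced {n k : ℕ} (v : Fin k → Fin n → ℤ) : Prop where
  linearIndependent : LinearIndependent ℤ v
  size_reduced : ∀ i j : Fin k, j < i → |gsCoeff v i j| ≤ 1 / 2
  lovasz : ∀ i j : Fin k, i.val + 1 = j.val →
    (3 / 4 - gsCoeff v j i ^ 2) * ‖gs v i‖ ^ 2 ≤ ‖gs v j‖ ^ 2

/-- `w` is the first vector of an LLL-reduced basis of the lattice `L`. -/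
def IsLLLFirst {n : ℕ} (L : Submodule ℤ (Fin n → ℤ)) (w : Fin n → ℤ) : Prop :=
  ∃ (k : ℕ) (v : Fin (k + 1) → Fin n → ℤ),
    IsLLLReduced v ∧ Submodule.span ℤ (Set.range v) = L ∧ w = v 0

/-! ### Kernels modulo integers -/

/-- The kernel of an integer matrix modulo `q`. -/
def kerMod {l n : ℕ} (M : Matrix (Fin l) (Fin n) ℤ) (q : ℕ) :
    Submodule (ZMod q) (Fin n → ZMod q) :=
  LinearMap.ker (M.map (Int.cast : ℤ → ZMod q)).mulVecLin

/-- The matrix with rows `V 0, …, V (m-1)` is in reduced row echelon form without zero rows. -/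
def IsRowReduced {R : Type*} [CommRing R] {m n : ℕ} (V : Fin m → Fin n → R) : Prop :=
  ∃ piv : Fin m → Fin n, StrictMono piv ∧ (∀ i, V i (piv i) = 1) ∧
    (∀ i j, j < piv i → V i j = 0) ∧ (∀ i k, k ≠ i → V k (piv i) = 0)

/-- `V` is a row-reduced basis of the kernel of `M` modulo `p`. -/
structure IsRowReducedKerBasis {l n : ℕ} (M : Matrix (Fin l) (Fin n) ℤ) (p : ℕ) {m : ℕ}
    (V : Fin m → Fin n → ZMod p) : Prop where
  rowReduced : IsRowReduced V
  linearIndependent : LinearIndependent (ZMod p) V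
  span_eq : Submodule.span (ZMod p) (Set.range V) = kerMod M p

/-- Member number `i` of a finite family of vectors, continued by zero vectors. -/
def pad {R : Type*} [CommRing R] {m n : ℕ} (V : Fin m → Fin n → R) (i : ℕ) : Fin n → R :=
  if h : i < m then V ⟨i, h⟩ else 0

/-- Chinese remaindering, componentwise: member number `i` of the result is congruent to `V i`
modulo `q` and to `W i` modulo `p`.  If one of the families is shorter, it is filled up by zero
vectors. -/
def merge {q p m l n : ℕ} (h : Nat.Coprime q p) (V : Fin m → Fin n → ZMod q)
    (W : Fin l → Fin n → ZMod p) : Fin (max m l) → Fin n → ZMod (q * p) :=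
  fun i k => (ZMod.chineseRemainder h).symm (pad V i.val k, pad W i.val k)

/-- The lattice generated by `V ∪ {q e_1, …, q e_n}`, where the vectors of `V` are represented by
integer vectors with entries in `{0, …, q-1}`. -/
def lattice {q m n : ℕ} (V : Fin m → Fin n → ZMod q) : Submodule ℤ (Fin n → ℤ) :=
  Submodule.span ℤ
    (Set.range (fun (i : Fin m) (k : Fin n) => ((V i k).val : ℤ)) ∪
      Set.range (fun i : Fin n => (Pi.single i (q : ℤ) : Fin n → ℤ)))

/-! ### The algorithm as a transition system -/

/-- The states of the algorithm: before the choice of the first prime; at the beginning of the loop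
body; after the merging step; after termination.  The result `none` stands for
"no recurrence found". -/
inductive State (n : ℕ) : Type
  | start : State n
  | loop (q : ℕ) {m : ℕ} (V : Fin m → Fin n → ZMod q) : State n
  | merged (q : ℕ) {m : ℕ} (V : Fin m → Fin n → ZMod q) : State n
  | done (result : Option (Fin n → ℤ)) : State n

/-- The transitions of the algorithm for the integer matrix `M` and the first prime `p₀`, where
`good w` is the exit condition of the loop.  The moduli `q` are the products of the primes used so
far, so that a prime is new if and only if it is coprime to `q`. -/
inductive Step {l n : ℕ} (M : Matrix (Fin l) (Fin n) ℤ) (good : (Fin n → ℤ) → Prop) (p₀ : ℕ) :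
    State n → State n → Prop
  | fail (V : Fin 0 → Fin n → ZMod p₀) (hV : IsRowReducedKerBasis M p₀ V) :
      Step M good p₀ State.start (State.done none)
  | enter {m : ℕ} (hm : m ≠ 0) (V : Fin m → Fin n → ZMod p₀)
      (hV : IsRowReducedKerBasis M p₀ V) :
      Step M good p₀ State.start (State.loop p₀ V)
  | newPrime {q m p k : ℕ} (V : Fin m → Fin n → ZMod q) (hp : p.Prime) (hqp : Nat.Coprime q p)
      (W : Fin k → Fin n → ZMod p) (hW : IsRowReducedKerBasis M p W) :
      Step M good p₀ (State.loop q V) (State.merged (q * p) (merge hqp V W))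
  | success {q m : ℕ} (V : Fin m → Fin n → ZMod q) (w : Fin n → ℤ)
      (hw : IsLLLFirst (lattice V) w) (hgood : good w) :
      Step M good p₀ (State.merged q V) (State.done (some w))
  | again {q m : ℕ} (V : Fin m → Fin n → ZMod q) (w : Fin n → ℤ)
      (hw : IsLLLFirst (lattice V) w) (hbad : ¬ good w) :
      Step M good p₀ (State.merged q V) (State.loop q V)

/-- `s` occurs in some run of the algorithm. -/
def Reachable {n : ℕ} (step : State n → State n → Prop) (s : State n) : Prop :=
  Relation.ReflTransGen step State.start s

/-- Every run of the algorithm ends after finitely many steps with a result: there is no infinite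
run, and no run gets stuck in a state that is not final. -/
def Terminates {n : ℕ} (step : State n → State n → Prop) : Prop :=
  (¬ ∃ s : ℕ → State n, s 0 = State.start ∧ ∀ k, step (s k) (s (k + 1))) ∧
    ∀ s, Reachable step s → (∃ result, s = State.done result) ∨ ∃ s', step s s'

/-- A prime is unlucky if `M` has a nontrivial kernel modulo `p` but not over the integers. -/
def Unlucky {l n : ℕ} (M : Matrix (Fin l) (Fin n) ℤ) (p : ℕ) : Prop :=
  (∀ x : Fin n → ℤ, M.mulVec x = 0 → x = 0) ∧ kerMod M p ≠ ⊥

/-- The output specification.  A result `w` has to be the coefficient vector of a nontrivial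
recurrence of order at most `r` and degree at most `d` that matches the data, and its length has to
be at most `2 ^ ((r+1)(d+1))` times the length of any other integer coefficient vector of such a
recurrence.  The answer "no recurrence found" has to mean that there is no such recurrence. -/
def Correct {N : ℕ} (a : Fin (N + 1) → ℚ) (b : ℕ → Polynomial ℚ) (r d : ℕ) :
    Option (Fin ((d + 1) * (r + 1)) → ℤ) → Prop
  | some w => recurrenceOf b r d w ≠ 0 ∧ (∀ i, (recurrenceOf b r d w i).natDegree ≤ d) ∧
      Matches a (recurrenceOf b r d w) ∧
      ∀ x : Fin ((d + 1) * (r + 1)) → ℤ, x ≠ 0 → Matches a (recurrenceOf b r d x) →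
        len w ≤ 2 ^ ((r + 1) * (d + 1)) * len x
  | none => ∀ P : Fin (r + 1) → Polynomial ℚ, (∀ i, (P i).natDegree ≤ d) → Matches a P → P = 0

/-- The transitions of the algorithm for the data `a`, the polynomials `b`, order `r` and degree
`d`, where `M` is the matrix of the linear system after clearing denominators. -/
def AlgStep {N : ℕ} (a : Fin (N + 1) → ℚ) (b : ℕ → Polynomial ℚ) (r d : ℕ)
    (M : Matrix (Fin (N + 1 - r)) (Fin ((d + 1) * (r + 1))) ℤ) (p₀ : ℕ) :
    State ((d + 1) * (r + 1)) → State ((d + 1) * (r + 1)) → Prop :=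
  Step M (fun w => Matches a (recurrenceOf b r d w)) p₀

end Guess

namespace Guess

open Matrix

/-! ### Linear algebra -/

/-! Everything rests on one invariant: the current family `V` generates the kernel of `M` modulo
`q`. It need not be a basis, and the echelon shapes for different primes need not agree. By the
Chinese remainder theorem the kernel modulo `q * p` is the product of the two kernels, and
coefficients can be merged just like vectors, so merging any two generating families, padded by
zeros, preserves the invariant (`span_merge`). Hence the lattice is exactly the set of `w` with `M w
≡ 0` modulo `q` (`mem_lattice_iff`); it contains the integer kernel, and the LLL estimate
(`IsLLLFirst.len_le`) gives the length bound for every result. The answer "no recurrence found" is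
right because a nonzero integer kernel vector, divided by its content, stays nonzero modulo `p`.

For termination, a lattice vector outside the integer kernel has an entry of `M w` that is a nonzero
multiple of `q`, so its length is at least a constant times `q` (`exists_lt_len`). Each pass at
least doubles `q`; once `q` is large compared with a fixed nonzero kernel vector, the LLL bound
forces the first reduced vector into the integer kernel. Such a kernel vector exists if the loop is
entered with a prime that is not unlucky, and unlucky primes divide `det (Mᵀ M) ≠ 0`.

That no run gets stuck requires row-reduced bases, new primes and LLL-reduced bases to exist; the
last are found by minimizing Gram determinants (`exists_isLLLReduced`). -/

/-- Every subspace of `K ^ n` has a basis in reduced row echelon form. -/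
theorem exists_isRowReduced_basis {K : Type*} [Field K] {n : ℕ}
    (U : Submodule K (Fin n → K)) :
    ∃ (m : ℕ) (V : Fin m → Fin n → K),
      IsRowReduced V ∧ LinearIndependent K V ∧ Submodule.span K (Set.range V) = U := by
  classical
  -- the set of positions of leading entries
  let J : Finset (Fin n) :=
    Finset.univ.filter fun j => ∃ u ∈ U, u j = 1 ∧ ∀ i < j, u i = 0
  have lead : ∀ u ∈ U, u ≠ 0 → ∃ j ∈ J, u j ≠ 0 ∧ ∀ i < j, u i = 0 := by
    intro u hu hu0
    have hne : (Finset.univ.filter fun j => u j ≠ 0).Nonempty := by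
      obtain ⟨j, hj⟩ := Function.ne_iff.1 hu0
      exact ⟨j, by simpa using hj⟩
    set j := (Finset.univ.filter fun j => u j ≠ 0).min' hne
    have hj : u j ≠ 0 := (Finset.mem_filter.1 (Finset.min'_mem _ hne)).2
    have hlt : ∀ i < j, u i = 0 := by
      intro i hi
      by_contra h
      exact absurd (Finset.min'_le _ i (by simpa using h)) (not_le.2 hi)
    refine ⟨j, ?_, hj, hlt⟩
    simp only [J, Finset.mem_filter, Finset.mem_univ, true_and]
    exact ⟨(u j)⁻¹ • u, U.smul_mem _ hu, by simp [hj], fun i hi => by simp [hlt i hi]⟩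
  let piv : Fin J.card → Fin n := J.orderEmbOfFin rfl
  have hpiv : StrictMono piv := (J.orderEmbOfFin rfl).strictMono
  have hmem : ∀ i, piv i ∈ J := fun i => J.orderEmbOfFin_mem rfl i
  have hsurj : ∀ j ∈ J, ∃ i, piv i = j := by
    intro j hj
    have : j ∈ Set.range (J.orderEmbOfFin rfl) := by simpa using hj
    exact this
  have hu : ∀ i, ∃ u ∈ U, u (piv i) = 1 ∧ ∀ k < piv i, u k = 0 := fun i => by
    simpa [J] using hmem i
  choose u huU hu1 hu0 using hu
  -- Restricted to the pivot columns the `u i` form a unitriangular matrix, whose inverse clears the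
  -- other entries of these columns.
  let T : Matrix (Fin J.card) (Fin J.card) K := fun i k => u i (piv k)
  have hT : IsUnit T.det := by
    have : T.det = 1 := by
      rw [Matrix.det_of_isUpperTriangular (M := T) (fun i k hik => hu0 i _ (hpiv hik))]
      exact Finset.prod_eq_one fun i _ => hu1 i
    simp [this]
  let V : Fin J.card → Fin n → K := fun i => ∑ k, T⁻¹ i k • u k
  have hVU : ∀ i, V i ∈ U := fun i =>
    U.sum_mem fun k _ => U.smul_mem _ (huU k)
  have hVpiv : ∀ i k, V i (piv k) = if i = k then 1 else 0 := by
    intro i k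
    have h := congrFun (congrFun (Matrix.nonsing_inv_mul T hT) i) k
    rw [Matrix.one_apply, Matrix.mul_apply] at h
    rw [← h]
    simp [V, T]
  -- A nonzero element of `U` has its leading position in `J`, so elements of `U` are determined by
  -- their pivot entries.
  have hzero : ∀ w ∈ U, (∀ k, w (piv k) = 0) → w = 0 := by
    intro w hw h
    by_contra hne
    obtain ⟨j, hj, hwj, -⟩ := lead w hw hne
    obtain ⟨k, rfl⟩ := hsurj j hj
    exact hwj (h k)
  refine ⟨J.card, V, ⟨piv, hpiv, fun i => by simp [hVpiv], ?_, fun i k hk => by simp [hVpiv, hk]⟩,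
    ?_, ?_⟩
  · intro i j hj
    have hne : V i ≠ 0 := fun h => by simpa [h] using hVpiv i i
    obtain ⟨j', hj', hne', hlt⟩ := lead (V i) (hVU i) hne
    obtain ⟨k, rfl⟩ := hsurj j' hj'
    have : i = k := by
      by_contra h
      exact hne' (by simp [hVpiv, h])
    subst this
    exact hlt j hj
  · rw [Fintype.linearIndependent_iff]
    intro g hg i
    have := congrFun hg (piv i)
    simpa [hVpiv] using this
  · refine le_antisymm (Submodule.span_le.2 (Set.range_subset_iff.2 hVU)) fun w hw => ?_
    have hsum : ∑ i, w (piv i) • V i ∈ Submodule.span K (Set.range V) :=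
      Submodule.sum_mem _ fun i _ => Submodule.smul_mem _ _ (Submodule.subset_span ⟨i, rfl⟩)
    have hle : Submodule.span K (Set.range V) ≤ U :=
      Submodule.span_le.2 (Set.range_subset_iff.2 hVU)
    have := hzero (w - ∑ i, w (piv i) • V i) (U.sub_mem hw (hle hsum))
      (fun k => by simp [hVpiv])
    rw [sub_eq_zero.1 this]
    exact hsum

theorem exists_isRowReducedKerBasis {l n : ℕ} (M : Matrix (Fin l) (Fin n) ℤ) {p : ℕ}
    (hp : p.Prime) :
    ∃ (m : ℕ) (V : Fin m → Fin n → ZMod p), IsRowReducedKerBasis M p V := by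
  have := Fact.mk hp
  obtain ⟨m, V, h1, h2, h3⟩ := exists_isRowReduced_basis (kerMod M p)
  exact ⟨m, V, h1, h2, h3⟩

/-- `Mᵀ M x = 0` gives `M x ⬝ᵥ M x = 0`, and a sum of integer squares vanishes only trivially. -/
theorem det_transpose_mul_self_ne_zero {l n : Type*} [Fintype l] [Fintype n] [DecidableEq n]
    (M : Matrix l n ℤ) (h : ∀ x, M *ᵥ x = 0 → x = 0) : (Mᵀ * M).det ≠ 0 := by
  intro h0
  obtain ⟨x, hx, hGx⟩ := Matrix.exists_mulVec_eq_zero_iff.2 h0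
  refine hx (h x ?_)
  rw [← dotProduct_self_eq_zero, Matrix.dotProduct_mulVec, ← Matrix.mulVec_transpose,
    Matrix.mulVec_mulVec, hGx, zero_dotProduct]

theorem mem_kerMod {l n : ℕ} {M : Matrix (Fin l) (Fin n) ℤ} {q : ℕ} {x : Fin n → ZMod q} :
    x ∈ kerMod M q ↔ M.map (Int.cast : ℤ → ZMod q) *ᵥ x = 0 := Iff.rfl

theorem map_mulVec_intCast {l n : ℕ} (M : Matrix (Fin l) (Fin n) ℤ) {R : Type*} [CommRing R]
    (w : Fin n → ℤ) (i : Fin l) :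
    (M.map (Int.cast : ℤ → R) *ᵥ fun k => (w k : R)) i = ((M *ᵥ w) i : ℤ) := by
  simp [Matrix.mulVec, dotProduct]

theorem intCast_mem_kerMod {l n : ℕ} {M : Matrix (Fin l) (Fin n) ℤ} {q : ℕ} {w : Fin n → ℤ} :
    (fun k => (w k : ZMod q)) ∈ kerMod M q ↔ ∀ i, (q : ℤ) ∣ (M *ᵥ w) i := by
  rw [mem_kerMod, funext_iff]
  refine forall_congr' fun i => ?_
  rw [map_mulVec_intCast, Pi.zero_apply, ZMod.intCast_zmod_eq_zero_iff_dvd]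

/-- A kernel vector modulo `p` is also killed by `Mᵀ M` modulo `p`, so an unlucky `p` divides the
nonzero integer `det (Mᵀ M)`. -/
theorem finite_unlucky {l n : ℕ} (M : Matrix (Fin l) (Fin n) ℤ) :
    {p : ℕ | p.Prime ∧ Unlucky M p}.Finite := by
  by_cases h : ∀ x : Fin n → ℤ, M *ᵥ x = 0 → x = 0
  swap
  · refine Set.Finite.subset Set.finite_empty fun p hp => h hp.2.1
  have hdet := det_transpose_mul_self_ne_zero M h
  refine Set.Finite.subset (Nat.divisors (Mᵀ * M).det.natAbs).finite_toSet ?_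
  rintro p ⟨hp, -, hne⟩
  have := Fact.mk hp
  rw [Finset.mem_coe, Nat.mem_divisors]
  refine ⟨?_, by simpa using hdet⟩
  by_contra hdvd
  refine hne ((Submodule.eq_bot_iff _).2 fun x hx => ?_)
  rw [mem_kerMod] at hx
  set M' := M.map (Int.cast : ℤ → ZMod p) with hM'
  have hcast : (M'ᵀ * M').det = ((Mᵀ * M).det : ℤ) := by
    have h1 : M'ᵀ * M' = (Int.castRingHom (ZMod p)).mapMatrix (Mᵀ * M) := by
      ext i j; simp [hM', Matrix.mul_apply]
    rw [h1, ← RingHom.map_det]; rfl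
  have hd : (M'ᵀ * M').det ≠ 0 := by
    rw [hcast, Ne, ZMod.intCast_zmod_eq_zero_iff_dvd]
    rwa [← Int.natCast_dvd] at hdvd
  by_contra hx0
  exact hd (Matrix.exists_mulVec_eq_zero_iff.1 ⟨x, hx0, by
    rw [← Matrix.mulVec_mulVec, hx, Matrix.mulVec_zero]⟩)

theorem exists_eq_smul_not_dvd {n p : ℕ} (hp : p.Prime) {x : Fin n → ℤ} (hx : x ≠ 0) :
    ∃ (y : Fin n → ℤ) (g : ℤ), g ≠ 0 ∧ x = g • y ∧ ∃ i, ¬ (p : ℤ) ∣ y i := by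
  have hx' : ∃ i, x i ≠ 0 := Function.ne_iff.1 hx
  obtain ⟨i₀, hi₀⟩ := hx'
  obtain ⟨f, hf, h1⟩ := Finset.extract_gcd x (s := Finset.univ) ⟨i₀, Finset.mem_univ _⟩
  refine ⟨f, Finset.univ.gcd x, ?_, ?_, ?_⟩
  · intro h
    exact hi₀ (Finset.gcd_eq_zero_iff.1 h i₀ (Finset.mem_univ _))
  · ext i
    simpa using hf i (Finset.mem_univ _)
  · by_contra! hall
    have : (p : ℤ) ∣ 1 := h1 ▸ Finset.dvd_gcd fun i _ => hall i
    exact (Nat.prime_iff_prime_int.1 hp).not_isUnit (isUnit_of_dvd_one this)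

/-- If the kernel modulo some prime is trivial, then so is the integer kernel. -/
theorem eq_zero_of_kerMod_eq_bot {l n p : ℕ} {M : Matrix (Fin l) (Fin n) ℤ} (hp : p.Prime)
    (h : kerMod M p = ⊥) (x : Fin n → ℤ) (hx : M *ᵥ x = 0) : x = 0 := by
  by_contra hx0
  obtain ⟨y, g, hg, rfl, i, hi⟩ := exists_eq_smul_not_dvd hp hx0
  rw [Matrix.mulVec_smul, smul_eq_zero_iff_right hg] at hx
  have hy : (fun k => (y k : ZMod p)) ∈ kerMod M p :=
    intCast_mem_kerMod.2 fun i => by simp [hx]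
  rw [h, Submodule.mem_bot] at hy
  exact hi ((ZMod.intCast_zmod_eq_zero_iff_dvd _ _).1 (congrFun hy i))

end Guess

namespace Guess

open Matrix

/-! ### Lattices of modular kernels -/

/-- The vectors `q e_k` make membership depend only on residues modulo `q`, and the residues of the
remaining generators span the modular kernel. -/
theorem mem_lattice_iff {l q m n : ℕ} [NeZero q] {M : Matrix (Fin l) (Fin n) ℤ}
    {V : Fin m → Fin n → ZMod q} (hV : Submodule.span (ZMod q) (Set.range V) = kerMod M q)
    (w : Fin n → ℤ) : w ∈ lattice V ↔ ∀ i, (q : ℤ) ∣ (M *ᵥ w) i := by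
  rw [← intCast_mem_kerMod]
  constructor
  · intro hw
    induction hw using Submodule.span_induction with
    | mem x hx =>
      rcases hx with ⟨i, rfl⟩ | ⟨i, rfl⟩
      · have : (fun k => (((V i k).val : ℤ) : ZMod q)) = V i := by
          ext k; simp
        rw [this, ← hV]
        exact Submodule.subset_span ⟨i, rfl⟩
      · have : (fun k => ((Pi.single i (q : ℤ) : Fin n → ℤ) k : ZMod q)) = 0 := by
          ext k
          by_cases h : k = i
          · subst h; simp
          · simp [h]
        rw [this]
        exact Submodule.zero_mem _
    | zero =>
      have : (fun k => (((0 : Fin n → ℤ) k : ℤ) : ZMod q)) = 0 := by ext; simp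
      rw [this]
      exact Submodule.zero_mem _
    | add x y _ _ hx hy =>
      have := Submodule.add_mem _ hx hy
      convert this using 1
      ext; simp
    | smul c x _ hx =>
      have := Submodule.smul_mem _ (c : ZMod q) hx
      convert this using 1
      ext; simp
  · intro hw
    rw [← hV, Submodule.mem_span_range_iff_exists_fun] at hw
    obtain ⟨c, hc⟩ := hw
    have hdvd : ∀ k, (q : ℤ) ∣ w k - ∑ i, ((c i).val : ℤ) * ((V i k).val : ℤ) := by
      intro k
      rw [← ZMod.intCast_zmod_eq_zero_iff_dvd]
      have := congrFun hc k
      simp only [Finset.sum_apply, Pi.smul_apply, smul_eq_mul] at this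
      push_cast
      rw [← this]
      simp
    choose t ht using hdvd
    have : w = ∑ i, ((c i).val : ℤ) • (fun k => ((V i k).val : ℤ)) +
        ∑ k, t k • (Pi.single k (q : ℤ) : Fin n → ℤ) := by
      ext k
      have h := ht k
      simp only [Pi.add_apply, Finset.sum_apply, Pi.smul_apply, smul_eq_mul, Pi.single_apply,
        mul_ite, mul_zero, Finset.sum_ite_eq, Finset.mem_univ, if_true]
      linarith
    rw [this]
    exact Submodule.add_mem _
      (Submodule.sum_mem _ fun i _ => Submodule.smul_mem _ _
        (Submodule.subset_span (Or.inl ⟨i, rfl⟩)))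
      (Submodule.sum_mem _ fun k _ => Submodule.smul_mem _ _
        (Submodule.subset_span (Or.inr ⟨k, rfl⟩)))

/-- Zero vectors do not change a span; padding gives two families a common index set, so that their
coefficients can be merged. -/
theorem mem_span_range_iff_exists_pad {R : Type*} [CommRing R] {m n : ℕ} (V : Fin m → Fin n → R)
    {k : ℕ} (hk : m ≤ k) (x : Fin n → R) :
    x ∈ Submodule.span R (Set.range V) ↔ ∃ c : Fin k → R, ∑ i, c i • pad V i = x := by
  constructor
  · intro hx
    rw [Submodule.mem_span_range_iff_exists_fun] at hx
    obtain ⟨c, rfl⟩ := hx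
    refine ⟨fun i => if h : i.val < m then c ⟨i, h⟩ else 0, ?_⟩
    obtain ⟨e, rfl⟩ := Nat.exists_eq_add_of_le hk
    rw [Fin.sum_univ_add]
    simp [pad]
  · rintro ⟨c, rfl⟩
    refine Submodule.sum_mem _ fun i _ => Submodule.smul_mem _ _ ?_
    unfold pad
    split_ifs with h
    · exact Submodule.subset_span ⟨_, rfl⟩
    · exact Submodule.zero_mem _

theorem mem_kerMod_mul {l n q p : ℕ} (h : q.Coprime p) {M : Matrix (Fin l) (Fin n) ℤ}
    (x : Fin n → ZMod (q * p)) :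
    x ∈ kerMod M (q * p) ↔ (fun k => (ZMod.chineseRemainder h (x k)).1) ∈ kerMod M q ∧
      (fun k => (ZMod.chineseRemainder h (x k)).2) ∈ kerMod M p := by
  simp only [mem_kerMod, funext_iff, ← forall_and]
  refine forall_congr' fun i => ?_
  rw [Pi.zero_apply, ← map_eq_zero_iff _ (ZMod.chineseRemainder h).injective, Prod.ext_iff]
  simp [Matrix.mulVec, dotProduct, map_sum, Prod.fst_sum, Prod.snd_sum]

theorem span_merge {l n q p m k : ℕ} (h : q.Coprime p) {M : Matrix (Fin l) (Fin n) ℤ}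
    {V : Fin m → Fin n → ZMod q} {W : Fin k → Fin n → ZMod p}
    (hV : Submodule.span (ZMod q) (Set.range V) = kerMod M q)
    (hW : Submodule.span (ZMod p) (Set.range W) = kerMod M p) :
    Submodule.span (ZMod (q * p)) (Set.range (merge h V W)) = kerMod M (q * p) := by
  ext x
  rw [mem_kerMod_mul h, ← hV, ← hW, mem_span_range_iff_exists_pad V (le_max_left m k),
    mem_span_range_iff_exists_pad W (le_max_right m k), Submodule.mem_span_range_iff_exists_fun]
  constructor
  · rintro ⟨c, rfl⟩
    refine ⟨⟨fun i => (ZMod.chineseRemainder h (c i)).1, ?_⟩,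
      ⟨fun i => (ZMod.chineseRemainder h (c i)).2, ?_⟩⟩ <;> ext j <;>
    simp [merge, map_sum, Prod.fst_sum, Prod.snd_sum]
  · rintro ⟨⟨c, hc⟩, ⟨e, he⟩⟩
    refine ⟨fun i => (ZMod.chineseRemainder h).symm (c i, e i), ?_⟩
    ext j
    apply (ZMod.chineseRemainder h).injective
    have hc := congrFun hc j
    have he := congrFun he j
    refine Prod.ext ?_ ?_
    · rw [← hc]; simp [merge, map_sum, Prod.fst_sum]
    · rw [← he]; simp [merge, map_sum, Prod.snd_sum]

/-! ### Invariants of the algorithm -/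

/-- The invariant of the algorithm: the modulus is positive and the vectors generate the kernel. -/
def Invariant {l n : ℕ} (M : Matrix (Fin l) (Fin n) ℤ) : State n → Prop
  | .start => True
  | .loop q V => q ≠ 0 ∧ Submodule.span (ZMod q) (Set.range V) = kerMod M q
  | .merged q V => q ≠ 0 ∧ Submodule.span (ZMod q) (Set.range V) = kerMod M q
  | .done _ => True

theorem Step.invariant {l n p₀ : ℕ} {M : Matrix (Fin l) (Fin n) ℤ} {good : (Fin n → ℤ) → Prop}
    (hp₀ : p₀.Prime) {s t : State n} (h : Step M good p₀ s t) (hs : Invariant M s) :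
    Invariant M t := by
  cases h with
  | fail => trivial
  | enter hm V hV => exact ⟨hp₀.ne_zero, hV.span_eq⟩
  | newPrime V hp hqp W hW => exact ⟨mul_ne_zero hs.1 hp.ne_zero, span_merge hqp hs.2 hW.span_eq⟩
  | success => trivial
  | again => exact hs

theorem Reachable.invariant {l n p₀ : ℕ} {M : Matrix (Fin l) (Fin n) ℤ}
    {good : (Fin n → ℤ) → Prop} (hp₀ : p₀.Prime) {s : State n}
    (h : Reachable (Step M good p₀) s) : Invariant M s := by
  induction h with
  | refl => trivial
  | tail _ hst ih => exact hst.invariant hp₀ ih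

end Guess

namespace Guess

open Matrix InnerProductSpace

/-! ### Gram–Schmidt orthogonalization of integer vectors -/

theorem toEuc_add {n : ℕ} (v w : Fin n → ℤ) : toEuc (v + w) = toEuc v + toEuc w := by
  ext i; simp [toEuc]

theorem toEuc_sub {n : ℕ} (v w : Fin n → ℤ) : toEuc (v - w) = toEuc v - toEuc w := by
  ext i; simp [toEuc]

theorem toEuc_smul {n : ℕ} (c : ℤ) (v : Fin n → ℤ) : toEuc (c • v) = (c : ℝ) • toEuc v := by
  ext i; simp [toEuc]

theorem toEuc_sum {n : ℕ} {ι : Type*} (s : Finset ι) (v : ι → Fin n → ℤ) :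
    toEuc (∑ i ∈ s, v i) = ∑ i ∈ s, toEuc (v i) := by
  ext i; simp [toEuc]

theorem inner_toEuc {n : ℕ} (v w : Fin n → ℤ) :
    inner ℝ (toEuc v) (toEuc w) = ((v ⬝ᵥ w : ℤ) : ℝ) := by
  simp [toEuc, PiLp.inner_apply, dotProduct, mul_comm]

section GramSchmidt

variable {n k : ℕ} (v : Fin k → Fin n → ℤ)

theorem inner_gs_of_ne {i j : Fin k} (h : i ≠ j) : inner ℝ (gs v i) (gs v j) = 0 :=
  gramSchmidt_orthogonal ℝ _ h

theorem inner_toEuc_gs_of_lt {i j : Fin k} (h : i < j) : inner ℝ (toEuc (v i)) (gs v j) = 0 := by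
  rw [real_inner_comm]
  exact gramSchmidt_inv_triangular ℝ (fun i => toEuc (v i)) h

theorem toEuc_eq_gs_add_sum (i : Fin k) :
    toEuc (v i) = gs v i + ∑ j ∈ Finset.Iio i, gsCoeff v i j • gs v j := by
  have := gramSchmidt_def'' ℝ (fun i => toEuc (v i)) i
  rw [this]
  simp only [gsCoeff, gs, real_inner_comm]
  congr

theorem inner_toEuc_gs_self (i : Fin k) : inner ℝ (toEuc (v i)) (gs v i) = ‖gs v i‖ ^ 2 := by
  rw [toEuc_eq_gs_add_sum, inner_add_left, sum_inner, real_inner_self_eq_norm_sq]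
  rw [Finset.sum_eq_zero, add_zero]
  intro j hj
  rw [inner_smul_left, inner_gs_of_ne v (Finset.mem_Iio.1 hj).ne, mul_zero]

theorem gsCoeff_of_lt {i j : Fin k} (h : i < j) : gsCoeff v i j = 0 := by
  rw [gsCoeff, inner_toEuc_gs_of_lt v h, zero_div]

/-- The unitriangular matrix of Gram–Schmidt coefficients. -/
noncomputable def gsMatrix : Matrix (Fin k) (Fin k) ℝ :=
  fun i j => if i = j then 1 else gsCoeff v i j

theorem toEuc_eq_sum_gsMatrix (i : Fin k) : toEuc (v i) = ∑ j, gsMatrix v i j • gs v j := by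
  rw [toEuc_eq_gs_add_sum, ← Finset.add_sum_erase _ _ (Finset.mem_univ i)]
  congr 1
  · simp [gsMatrix]
  · refine Finset.sum_subset_zero_on_sdiff (fun j hj => ?_) (fun j hj => ?_) (fun j hj => ?_)
    · simpa using (Finset.mem_Iio.1 hj).ne
    · simp only [Finset.mem_sdiff, Finset.mem_erase, Finset.mem_univ, and_true, Finset.mem_Iio,
        not_lt] at hj
      rw [gsMatrix, if_neg (Ne.symm hj.1), gsCoeff_of_lt v (lt_of_le_of_ne hj.2 (Ne.symm hj.1)),
        zero_smul]
    · rw [gsMatrix, if_neg (Finset.mem_Iio.1 hj).ne']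

/-- The Gram determinant of the vectors with index at most `i`. -/
def gramDet (i : Fin k) : ℤ :=
  (Matrix.of fun a b : {j : Fin k // j ≤ i} => v a ⬝ᵥ v b).det

theorem inner_toEuc_eq_sum (a b : Fin k) :
    inner ℝ (toEuc (v a)) (toEuc (v b)) =
      ∑ c, gsMatrix v a c * ‖gs v c‖ ^ 2 * gsMatrix v b c := by
  rw [toEuc_eq_sum_gsMatrix v a, toEuc_eq_sum_gsMatrix v b, sum_inner]
  refine Finset.sum_congr rfl fun c _ => ?_
  rw [inner_sum, Finset.sum_eq_single c]
  · rw [inner_smul_left, inner_smul_right, real_inner_self_eq_norm_sq]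
    simp; ring
  · intro d _ hd
    rw [inner_smul_left, inner_smul_right, inner_gs_of_ne v hd.symm]; simp
  · simp

theorem gsMatrix_of_lt {i j : Fin k} (h : i < j) : gsMatrix v i j = 0 := by
  rw [gsMatrix, if_neg h.ne, gsCoeff_of_lt v h]

/-- The Gram matrix factors as `U D Uᵀ` with `U` unitriangular and `D` the diagonal of squared
Gram–Schmidt norms. This ties an integer quantity to the real orthogonalization. -/
theorem gramDet_eq_prod (i : Fin k) :
    (gramDet v i : ℝ) = ∏ j ∈ Finset.Iic i, ‖gs v j‖ ^ 2 := by
  let U : Matrix {j : Fin k // j ≤ i} {j : Fin k // j ≤ i} ℝ := fun a b => gsMatrix v a b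
  have hU : U.det = 1 := by
    rw [Matrix.det_of_isLowerTriangular U (fun a b hab => gsMatrix_of_lt v (by simpa using hab))]
    exact Finset.prod_eq_one fun a _ => by simp [U, gsMatrix]
  have hG : (Matrix.of fun a b : {j : Fin k // j ≤ i} => v a ⬝ᵥ v b).map (Int.cast : ℤ → ℝ) =
      U * Matrix.diagonal (fun a : {j : Fin k // j ≤ i} => ‖gs v a‖ ^ 2) * Uᵀ := by
    ext a b
    rw [Matrix.map_apply, Matrix.of_apply, ← inner_toEuc, inner_toEuc_eq_sum, Matrix.mul_apply]
    rw [← Finset.sum_subset (Finset.subset_univ (Finset.Iic i)) (fun c _ hc => ?_)]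
    · rw [Finset.sum_subtype (p := (· ≤ i)) (Finset.Iic i) (fun x => by simp)]
      exact Finset.sum_congr rfl fun c _ => by rw [Matrix.mul_diagonal, Matrix.transpose_apply]
    · rw [gsMatrix_of_lt v (lt_of_le_of_lt a.2 (by simpa using hc)), zero_mul, zero_mul]
  have hd : (gramDet v i : ℝ) = ((Matrix.of fun a b : {j : Fin k // j ≤ i} => v a ⬝ᵥ v b).map
      (Int.cast : ℤ → ℝ)).det := by
    rw [gramDet]
    exact RingHom.map_det (Int.castRingHom ℝ) _
  rw [hd, hG, Matrix.det_mul, Matrix.det_mul, Matrix.det_transpose, hU, Matrix.det_diagonal,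
    one_mul, mul_one, Finset.prod_subtype (p := (· ≤ i)) (Finset.Iic i) (fun x => by simp)]

/-- Take the largest `i` with `c i ≠ 0`: the later vectors do not occur, and the earlier ones are
orthogonal to `gs v i`. -/
theorem exists_inner_sum_smul_gs {c : Fin k → ℤ} (hc : c ≠ 0) :
    ∃ i, c i ≠ 0 ∧ inner ℝ (toEuc (∑ j, c j • v j)) (gs v i) = c i * ‖gs v i‖ ^ 2 := by
  classical
  have hne : (Finset.univ.filter fun j => c j ≠ 0).Nonempty := by
    obtain ⟨j, hj⟩ := Function.ne_iff.1 hc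
    exact ⟨j, by simpa using hj⟩
  set i := (Finset.univ.filter fun j => c j ≠ 0).max' hne
  have hci : c i ≠ 0 := (Finset.mem_filter.1 (Finset.max'_mem _ hne)).2
  have hgt : ∀ j, i < j → c j = 0 := by
    intro j hj
    by_contra h
    exact absurd (Finset.le_max' _ j (by simpa using h)) (not_le.2 hj)
  refine ⟨i, hci, ?_⟩
  rw [toEuc_sum, sum_inner, Finset.sum_eq_single i]
  · rw [toEuc_smul, inner_smul_left, inner_toEuc_gs_self]; simp
  · intro j _ hj
    rw [toEuc_smul, inner_smul_left]
    rcases lt_or_gt_of_ne hj with h | h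
    · rw [inner_toEuc_gs_of_lt v h, mul_zero]
    · simp [hgt j h]
  · simp

variable {v}

theorem linearIndependent_of_gs_ne_zero (h : ∀ i, gs v i ≠ 0) : LinearIndependent ℤ v := by
  rw [Fintype.linearIndependent_iff]
  intro c hc
  by_contra! hne
  obtain ⟨i, hi, h'⟩ := exists_inner_sum_smul_gs v (c := c) (fun h0 => by simp [h0] at hne)
  have h0 : toEuc (0 : Fin n → ℤ) = 0 := by ext; simp [toEuc]
  rw [hc, h0, inner_zero_left, eq_comm, mul_eq_zero] at h'
  rcases h' with h' | h'
  · exact hi (by exact_mod_cast h')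
  · exact h i (by simpa using h')

theorem gramDet_ne_zero (h : LinearIndependent ℤ v) (i : Fin k) : gramDet v i ≠ 0 := by
  have h' : LinearIndependent ℤ fun a : {j : Fin k // j ≤ i} => v a :=
    h.comp _ Subtype.val_injective
  rw [Fintype.linearIndependent_iff] at h'
  exact det_transpose_mul_self_ne_zero
    (Matrix.of fun (b : Fin n) (a : {j : Fin k // j ≤ i}) => v a b) fun x hx => by
      ext a
      refine h' x ?_ a
      ext b
      have := congrFun hx b
      simpa [Matrix.mulVec, dotProduct, mul_comm] using this

/-- Independence is given over `ℤ` only; the nonvanishing integer Gram determinant carries it over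
to the real Gram–Schmidt vectors. -/
theorem gs_ne_zero (h : LinearIndependent ℤ v) (i : Fin k) : gs v i ≠ 0 := by
  have h1 : (gramDet v i : ℝ) ≠ 0 := by exact_mod_cast gramDet_ne_zero h i
  rw [gramDet_eq_prod, Finset.prod_ne_zero_iff] at h1
  simpa using h1 i (by simp)

theorem gramDet_eq_of_gs_eq {v' : Fin k → Fin n → ℤ} {i : Fin k}
    (h : ∀ j ≤ i, gs v' j = gs v j) : gramDet v' i = gramDet v i := by
  have : (gramDet v' i : ℝ) = gramDet v i := by
    rw [gramDet_eq_prod, gramDet_eq_prod]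
    exact Finset.prod_congr rfl fun j hj => by rw [h j (Finset.mem_Iic.1 hj)]
  exact_mod_cast this

theorem sum_starProjection_gs {i : Fin k} {x : EuclideanSpace ℝ (Fin n)}
    (hx : x ∈ Submodule.span ℝ (gs v '' Set.Iio i)) :
    ∑ j ∈ Finset.Iio i, (Submodule.span ℝ {gs v j}).starProjection x = x := by
  induction hx using Submodule.span_induction with
  | mem x hx =>
    obtain ⟨l, hl, rfl⟩ := hx
    rw [Finset.sum_eq_single l]
    · exact Submodule.starProjection_eq_self_iff.2 (Submodule.mem_span_singleton_self _)
    · intro j _ hj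
      rw [Submodule.starProjection_singleton, inner_gs_of_ne v hj]
      simp
    · intro h
      exact absurd (Finset.mem_Iio.2 hl) h
  | zero => simp
  | add x y _ _ hx hy => simp only [map_add, Finset.sum_add_distrib, hx, hy]
  | smul c x _ hx => simp only [map_smul, ← Finset.smul_sum, hx]

/-- The Gram–Schmidt vectors do not change if every vector is changed by a linear combination of
the preceding ones. -/
theorem gs_congr {v' : Fin k → Fin n → ℤ} {i : Fin k}
    (h : ∀ a ≤ i, toEuc (v' a) - toEuc (v a) ∈
      Submodule.span ℝ ((fun j => toEuc (v j)) '' Set.Iio a)) : gs v' i = gs v i := by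
  induction i using WellFoundedLT.induction with
  | _ i ih =>
    have ih' : ∀ j ∈ Finset.Iio i, gs v' j = gs v j := fun j hj =>
      ih j (Finset.mem_Iio.1 hj) fun a ha => h a (ha.trans (Finset.mem_Iio.1 hj).le)
    have hd := h i le_rfl
    -- The difference lies in the span of the earlier Gram–Schmidt vectors, so it equals the sum of
    -- its projections and cancels.
    rw [← span_gramSchmidt_Iio] at hd
    have hd' := sum_starProjection_gs hd
    have e' : gs v' i = toEuc (v' i) - ∑ j ∈ Finset.Iio i,
        (Submodule.span ℝ {gs v' j}).starProjection (toEuc (v' i)) := gramSchmidt_def ℝ _ i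
    have e : gs v i = toEuc (v i) - ∑ j ∈ Finset.Iio i,
        (Submodule.span ℝ {gs v j}).starProjection (toEuc (v i)) := gramSchmidt_def ℝ _ i
    have e'' : ∑ j ∈ Finset.Iio i, (Submodule.span ℝ {gs v' j}).starProjection (toEuc (v' i)) =
        ∑ j ∈ Finset.Iio i, (Submodule.span ℝ {gs v j}).starProjection (toEuc (v' i)) :=
      Finset.sum_congr rfl fun j hj => by rw [ih' j hj]
    simp only [map_sub, Finset.sum_sub_distrib] at hd'
    rw [e', e, e'']
    rw [sub_eq_sub_iff_sub_eq_sub]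
    exact hd'.symm

theorem toEuc_mem_span {a : Fin k} {u : Fin n → ℤ} (hu : u ∈ Submodule.span ℤ (v '' Set.Iio a)) :
    toEuc u ∈ Submodule.span ℝ ((fun j => toEuc (v j)) '' Set.Iio a) := by
  induction hu using Submodule.span_induction with
  | mem x hx =>
    obtain ⟨l, hl, rfl⟩ := hx
    exact Submodule.subset_span ⟨l, hl, rfl⟩
  | zero =>
    have h0 : toEuc (0 : Fin n → ℤ) = 0 := by ext; simp [toEuc]
    rw [h0]; exact Submodule.zero_mem _
  | add x y _ _ hx hy => rw [toEuc_add]; exact Submodule.add_mem _ hx hy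
  | smul c x _ hx => rw [toEuc_smul]; exact Submodule.smul_mem _ _ hx

/-! ### Existence of LLL-reduced bases -/

theorem exists_sub_size_reduced (h : ∀ i, gs v i ≠ 0) (i : Fin k) :
    ∃ u ∈ Submodule.span ℤ (v '' Set.Iio i), ∀ j < i,
      |inner ℝ (toEuc (v i - u)) (gs v j) / ‖gs v j‖ ^ 2| ≤ 1 / 2 := by
  -- The indices are treated downwards from `i - 1`, and `t` counts those done: subtracting a
  -- multiple of `v m` leaves the coefficients at `j > m` unchanged.
  suffices H : ∀ t ≤ i.val, ∃ u ∈ Submodule.span ℤ (v '' Set.Iio i), ∀ j < i, i.val - t ≤ j.val →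
      |inner ℝ (toEuc (v i - u)) (gs v j) / ‖gs v j‖ ^ 2| ≤ 1 / 2 by
    obtain ⟨u, hu, hu'⟩ := H i.val le_rfl
    exact ⟨u, hu, fun j hj => hu' j hj (by simp)⟩
  intro t
  induction t with
  | zero =>
    intro _
    exact ⟨0, Submodule.zero_mem _, fun j hj h' => by
      have : j.val < i.val := hj
      omega⟩
  | succ t ih =>
    intro ht
    obtain ⟨u, hu, hu'⟩ := ih (by omega)
    let m : Fin k := ⟨i.val - (t + 1), by omega⟩
    have hm : m < i := by
      change i.val - (t + 1) < i.val
      omega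
    set c : ℤ := round (inner ℝ (toEuc (v i - u)) (gs v m) / ‖gs v m‖ ^ 2)
    refine ⟨u + c • v m, Submodule.add_mem _ hu (Submodule.smul_mem _ _
      (Submodule.subset_span ⟨m, hm, rfl⟩)), fun j hj hmj => ?_⟩
    have hsplit : toEuc (v i - (u + c • v m)) = toEuc (v i - u) - (c : ℝ) • toEuc (v m) := by
      rw [← sub_sub, toEuc_sub _ (c • v m), toEuc_smul]
    rw [hsplit, inner_sub_left, inner_smul_left]
    by_cases hjm : j = m
    · rw [hjm]
      have hne : ‖gs v m‖ ^ 2 ≠ 0 := by simpa using h m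
      rw [inner_toEuc_gs_self, sub_div, conj_trivial, mul_div_cancel_right₀ _ hne]
      exact abs_sub_round _
    · have hlt : m < j := lt_of_le_of_ne hmj (Ne.symm hjm)
      rw [inner_toEuc_gs_of_lt v hlt, mul_zero, sub_zero]
      refine hu' j hj ?_
      have : i.val - (t + 1) < j.val := hlt
      omega

theorem exists_size_reduced (h : LinearIndependent ℤ v) :
    ∃ v' : Fin k → Fin n → ℤ, LinearIndependent ℤ v' ∧
      Submodule.span ℤ (Set.range v') = Submodule.span ℤ (Set.range v) ∧ gs v' = gs v ∧
      ∀ i j : Fin k, j < i → |gsCoeff v' i j| ≤ 1 / 2 := by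
  choose u hu hred using exists_sub_size_reduced (gs_ne_zero h)
  have hgs : gs (fun i => v i - u i) = gs v := by
    ext1 i
    refine gs_congr fun a _ => ?_
    rw [toEuc_sub, sub_sub_cancel_left]
    exact Submodule.neg_mem _ (toEuc_mem_span (hu a))
  refine ⟨fun i => v i - u i, linearIndependent_of_gs_ne_zero fun i => ?_, le_antisymm ?_ ?_, hgs,
    fun i j hij => ?_⟩
  · rw [hgs]; exact gs_ne_zero h i
  · refine Submodule.span_le.2 (Set.range_subset_iff.2 fun i => ?_)
    exact Submodule.sub_mem _ (Submodule.subset_span ⟨i, rfl⟩)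
      (Submodule.span_mono (Set.image_subset_range _ _) (hu i))
  · refine Submodule.span_le.2 (Set.range_subset_iff.2 fun i => ?_)
    induction i using WellFoundedLT.induction with
    | _ i ih =>
      have hle : Submodule.span ℤ (v '' Set.Iio i) ≤
          Submodule.span ℤ (Set.range fun i => v i - u i) :=
        Submodule.span_le.2 (Set.image_subset_iff.2 fun j hj => ih j hj)
      have := Submodule.add_mem _
        (Submodule.subset_span (R := ℤ) (s := Set.range fun i => v i - u i) ⟨i, rfl⟩) (hle (hu i))
      simpa using this
  · rw [gsCoeff, hgs]
    exact hred i j hij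

/-- Swapping two consecutive vectors that violate the Lovász condition makes the corresponding
Gram determinant smaller and keeps the preceding ones. -/
theorem gramDet_swap (hv : LinearIndependent ℤ v) {i j : Fin k} (hij : i.val + 1 = j.val)
    (h : ‖gs v j‖ ^ 2 < (3 / 4 - gsCoeff v j i ^ 2) * ‖gs v i‖ ^ 2) :
    (∀ l < i, gramDet (v ∘ Equiv.swap i j) l = gramDet v l) ∧
      (gramDet (v ∘ Equiv.swap i j) i).natAbs < (gramDet v i).natAbs := by
  have hlt : i < j := by
    change i.val < j.val
    omega
  have hgs : ∀ l < i, gs (v ∘ Equiv.swap i j) l = gs v l := by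
    intro l hl
    refine gs_congr fun a ha => ?_
    rw [Function.comp_apply, Equiv.swap_apply_of_ne_of_ne (ha.trans_lt hl).ne
      ((ha.trans_lt hl).trans hlt).ne, sub_self]
    exact Submodule.zero_mem _
  have hIio : Finset.Iio j = insert i (Finset.Iio i) := by
    ext l
    simp only [Finset.mem_Iio, Finset.mem_insert, Fin.lt_def, Fin.ext_iff]
    omega
  -- At position `i`, the vector `v j` is no longer projected away from `gs v i`, so that component
  -- survives.
  have hgsi : gs (v ∘ Equiv.swap i j) i = gs v j + gsCoeff v j i • gs v i := by
    have e : gs (v ∘ Equiv.swap i j) i = toEuc ((v ∘ Equiv.swap i j) i) - ∑ l ∈ Finset.Iio i,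
        (Submodule.span ℝ {gs (v ∘ Equiv.swap i j) l}).starProjection
          (toEuc ((v ∘ Equiv.swap i j) i)) := gramSchmidt_def ℝ _ i
    have e2 : toEuc ((v ∘ Equiv.swap i j) i) = toEuc (v j) := by simp
    have e3 : ∑ l ∈ Finset.Iio i, (Submodule.span ℝ {gs (v ∘ Equiv.swap i j) l}).starProjection
        (toEuc (v j)) = ∑ l ∈ Finset.Iio i, gsCoeff v j l • gs v l := by
      refine Finset.sum_congr rfl fun l hl => ?_
      rw [hgs l (Finset.mem_Iio.1 hl), Submodule.starProjection_singleton, gsCoeff,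
        real_inner_comm]
      simp
    rw [e, e2, e3, toEuc_eq_gs_add_sum v j, hIio, Finset.sum_insert (by simp)]
    abel
  refine ⟨fun l hl => gramDet_eq_of_gs_eq fun a ha => hgs a (ha.trans_lt hl), ?_⟩
  have hpos : ∀ l, 0 < ‖gs v l‖ ^ 2 := fun l => by
    have := gs_ne_zero hv l
    positivity
  have hnorm : ‖gs (v ∘ Equiv.swap i j) i‖ ^ 2 < ‖gs v i‖ ^ 2 := by
    rw [hgsi, ← real_inner_self_eq_norm_sq, inner_add_add_self, inner_smul_left, inner_smul_right,
      inner_smul_left, inner_smul_right, inner_gs_of_ne v hlt.ne, inner_gs_of_ne v hlt.ne',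
      real_inner_self_eq_norm_sq, real_inner_self_eq_norm_sq, conj_trivial]
    nlinarith [hpos i]
  have hIic : Finset.Iic i = insert i (Finset.Iio i) := by
    ext l
    simp [le_iff_eq_or_lt]
  have hprod : (gramDet (v ∘ Equiv.swap i j) i : ℝ) < gramDet v i := by
    rw [gramDet_eq_prod, gramDet_eq_prod, hIic, Finset.prod_insert (by simp),
      Finset.prod_insert (by simp),
      Finset.prod_congr rfl fun l hl => by rw [hgs l (Finset.mem_Iio.1 hl)]]
    exact mul_lt_mul_of_pos_right hnorm (Finset.prod_pos fun l _ => hpos l)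
  have hnonneg : (0 : ℝ) ≤ gramDet (v ∘ Equiv.swap i j) i := by
    rw [gramDet_eq_prod]
    exact Finset.prod_nonneg fun _ _ => sq_nonneg _
  have h1 : gramDet (v ∘ Equiv.swap i j) i < gramDet v i := by exact_mod_cast hprod
  have h2 : 0 ≤ gramDet (v ∘ Equiv.swap i j) i := by exact_mod_cast hnonneg
  exact Int.natAbs_lt_natAbs_of_nonneg_of_lt h2 h1

/-- Among the size-reduced bases of the same lattice, one with lexicographically least sequence of
Gram determinants satisfies the Lovász condition: otherwise a swap followed by size reduction, which
keeps the Gram–Schmidt vectors, would decrease the sequence. -/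
theorem exists_isLLLReduced (h : LinearIndependent ℤ v) :
    ∃ v' : Fin k → Fin n → ℤ, IsLLLReduced v' ∧
      Submodule.span ℤ (Set.range v') = Submodule.span ℤ (Set.range v) := by
  let S : Set (Fin k → Fin n → ℤ) := {v' | LinearIndependent ℤ v' ∧
    Submodule.span ℤ (Set.range v') = Submodule.span ℤ (Set.range v) ∧
      ∀ i j : Fin k, j < i → |gsCoeff v' i j| ≤ 1 / 2}
  let f : (Fin k → Fin n → ℤ) → Lex (Fin k → ℕ) :=
    fun v' => toLex fun i => (gramDet v' i).natAbs
  have hS : S.Nonempty := by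
    obtain ⟨v', h1, h2, -, h3⟩ := exists_size_reduced h
    exact ⟨v', h1, h2, h3⟩
  obtain ⟨v', ⟨h1, h2, h3⟩, hmin⟩ := (InvImage.wf f wellFounded_lt).has_min S hS
  refine ⟨v', ⟨h1, h3, fun i j hij => ?_⟩, h2⟩
  by_contra! hlov
  obtain ⟨hpre, hdec⟩ := gramDet_swap h1 hij hlov
  obtain ⟨v'', g1, g2, g3, g4⟩ :=
    exists_size_reduced (h1.comp _ (Equiv.swap i j).injective)
  have hdet : ∀ l, gramDet v'' l = gramDet (v' ∘ Equiv.swap i j) l := fun l =>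
    gramDet_eq_of_gs_eq fun a _ => by rw [g3]
  refine hmin v'' ⟨g1, ?_, g4⟩ ?_
  · rw [g2, ← h2, (Equiv.swap i j).surjective.range_comp]
  · refine ⟨i, fun l hl => ?_, ?_⟩
    · change (gramDet v'' l).natAbs = (gramDet v' l).natAbs
      rw [hdet, hpre l hl]
    · change (gramDet v'' i).natAbs < (gramDet v' i).natAbs
      rwa [hdet]

end GramSchmidt

theorem exists_isLLLFirst {n : ℕ} {L : Submodule ℤ (Fin n → ℤ)} (hL : L ≠ ⊥) :
    ∃ w, IsLLLFirst L w := by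
  obtain ⟨k, ⟨B⟩⟩ := Submodule.nonempty_basis_of_pid (Pi.basisFun ℤ (Fin n)) L
  have hk : k ≠ 0 := by
    rintro rfl
    refine hL ((Submodule.eq_bot_iff _).2 fun x hx => ?_)
    have h0 : (⟨x, hx⟩ : L) = 0 := B.ext_elem fun i => i.elim0
    exact congrArg Subtype.val h0
  obtain ⟨k, rfl⟩ := Nat.exists_eq_succ_of_ne_zero hk
  have hli : LinearIndependent ℤ fun i => (B i : Fin n → ℤ) :=
    B.linearIndependent.map' L.subtype (Submodule.ker_subtype L)
  obtain ⟨v, hv, hspan⟩ := exists_isLLLReduced hli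
  refine ⟨v 0, k, v, hv, ?_, rfl⟩
  rw [hspan, show (fun i => (B i : Fin n → ℤ)) = L.subtype ∘ B from rfl, Set.range_comp,
    ← Submodule.map_span, B.span_eq, Submodule.map_top, Submodule.range_subtype]

/-! ### The first vector of an LLL-reduced basis -/

/-- Size reduction bounds the squared coefficient by `1/4`, so the Lovász factor is at least `3/4 -
1/4 = 1/2`; each step costs a factor of 2. -/
theorem IsLLLReduced.norm_gs_zero_le {n k : ℕ} {v : Fin (k + 1) → Fin n → ℤ}
    (hv : IsLLLReduced v) (i : Fin (k + 1)) : ‖gs v 0‖ ^ 2 ≤ 2 ^ i.val * ‖gs v i‖ ^ 2 := by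
  induction i using Fin.induction with
  | zero => simp
  | succ i ih =>
    have hl := hv.lovasz i.castSucc i.succ (by simp)
    have hs := hv.size_reduced i.succ i.castSucc (by simp)
    have hsq : gsCoeff v i.succ i.castSucc ^ 2 ≤ 1 / 4 := by
      rw [← sq_abs]
      nlinarith [abs_nonneg (gsCoeff v i.succ i.castSucc)]
    have h2 : ‖gs v i.castSucc‖ ^ 2 ≤ 2 * ‖gs v i.succ‖ ^ 2 := by
      nlinarith [sq_nonneg ‖gs v i.castSucc‖]
    calc ‖gs v 0‖ ^ 2 ≤ 2 ^ i.castSucc.val * ‖gs v i.castSucc‖ ^ 2 := ih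
      _ ≤ 2 ^ i.castSucc.val * (2 * ‖gs v i.succ‖ ^ 2) := by gcongr
      _ = 2 ^ i.succ.val * ‖gs v i.succ‖ ^ 2 := by
        rw [Fin.val_succ, Fin.val_castSucc]; ring

/-- The first vector of an LLL-reduced basis is short. -/
theorem IsLLLFirst.len_le {n : ℕ} {L : Submodule ℤ (Fin n → ℤ)} {w : Fin n → ℤ}
    (hw : IsLLLFirst L w) {x : Fin n → ℤ} (hx : x ∈ L) (hx0 : x ≠ 0) :
    len w ≤ 2 ^ n * len x := by
  obtain ⟨k, v, hv, rfl, rfl⟩ := hw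
  have hk : k + 1 ≤ n := by
    simpa using hv.linearIndependent.fintype_card_le_finrank
  rw [Submodule.mem_span_range_iff_exists_fun] at hx
  obtain ⟨c, rfl⟩ := hx
  obtain ⟨i, hi, hin⟩ := exists_inner_sum_smul_gs v (c := c) (fun h0 => hx0 (by simp [h0]))
  set x := ∑ j, c j • v j
  have hgi : 0 < ‖gs v i‖ := norm_pos_iff.2 (gs_ne_zero hv.linearIndependent i)
  have hci : (1 : ℝ) ≤ |(c i : ℝ)| := by exact_mod_cast Int.one_le_abs hi
  -- Cauchy–Schwarz, with `|c i| ≥ 1` because `c i` is a nonzero integer.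
  have hle : ‖gs v i‖ ≤ len x := by
    have := abs_real_inner_le_norm (toEuc x) (gs v i)
    rw [hin, abs_mul, abs_of_nonneg (sq_nonneg ‖gs v i‖), pow_two, ← mul_assoc] at this
    have := le_of_mul_le_mul_right this hgi
    exact (le_mul_of_one_le_left hgi.le hci).trans this
  have h0 : gs v 0 = toEuc (v 0) := by
    have := toEuc_eq_gs_add_sum v 0
    have h : Finset.Iio (0 : Fin (k + 1)) = ∅ := by ext; simp
    rw [h, Finset.sum_empty, add_zero] at this
    exact this.symm
  have hlen : len (v 0) = ‖gs v 0‖ := by rw [h0]; rfl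
  have hx_nonneg : 0 ≤ len x := norm_nonneg _
  rw [hlen]
  refine le_of_sq_le_sq ?_ (by positivity)
  calc ‖gs v 0‖ ^ 2 ≤ 2 ^ i.val * ‖gs v i‖ ^ 2 := hv.norm_gs_zero_le i
    -- A generous bound: `i ≤ k < n` would allow a smaller exponent.
    _ ≤ 2 ^ (n * 2) * len x ^ 2 := by
      gcongr
      · norm_num
      · omega
    _ = (2 ^ n * len x) ^ 2 := by rw [mul_pow, pow_mul]

theorem IsLLLFirst.ne_zero {n : ℕ} {L : Submodule ℤ (Fin n → ℤ)} {w : Fin n → ℤ}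
    (hw : IsLLLFirst L w) : w ≠ 0 := by
  obtain ⟨k, v, hv, -, rfl⟩ := hw
  exact hv.linearIndependent.ne_zero 0

theorem IsLLLFirst.mem {n : ℕ} {L : Submodule ℤ (Fin n → ℤ)} {w : Fin n → ℤ}
    (hw : IsLLLFirst L w) : w ∈ L := by
  obtain ⟨k, v, hv, rfl, rfl⟩ := hw
  exact Submodule.subset_span ⟨0, rfl⟩

end Guess

namespace Guess

open Matrix

/-! ### Recurrences and coefficient vectors -/

/-- Stated for rational coefficients because the negative answer concerns all recurrences over
`ℚ[x]`. The reversal of `j` reflects the descending order of the blocks. -/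
theorem matches_sum_smul_iff {N : ℕ} (a : Fin (N + 1) → ℚ) (b : ℕ → Polynomial ℚ) (r d : ℕ)
    (y : Fin ((d + 1) * (r + 1)) → ℚ) :
    Matches a (fun i : Fin (r + 1) =>
      ∑ j : Fin (d + 1), y (finProdFinEquiv (Fin.rev j, i)) • b j.val) ↔
      guessMatrix a b r d *ᵥ y = 0 := by
  rw [Matches, funext_iff]
  refine forall_congr' fun n => ?_
  rw [Pi.zero_apply, Matrix.mulVec, dotProduct, ← finProdFinEquiv.sum_comp, Fintype.sum_prod_type,
    Finset.sum_comm]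
  refine iff_of_eq (congrArg (· = 0) (Finset.sum_congr rfl fun i _ => ?_))
  rw [Polynomial.eval_finsetSum, Finset.sum_mul, ← Equiv.sum_comp Fin.revPerm]
  refine Finset.sum_congr rfl fun j _ => ?_
  have h1 : (finProdFinEquiv (j, i)).divNat = j :=
    congrArg Prod.fst (finProdFinEquiv.symm_apply_apply (j, i))
  have h2 : (finProdFinEquiv (j, i)).modNat = i :=
    congrArg Prod.snd (finProdFinEquiv.symm_apply_apply (j, i))
  have h3 : d - j.val = (Fin.rev j).val := by
    rw [Fin.val_rev]; omega
  rw [guessMatrix, h1, h2, h3, Matrix.hadamard_apply, matA, matB, Fin.revPerm_apply, Fin.rev_rev,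
    Polynomial.eval_smul, smul_eq_mul]
  ring

section

variable {N : ℕ} {a : Fin (N + 1) → ℚ} {b : ℕ → Polynomial ℚ} {r d : ℕ} {c : ℤ}
  {M : Matrix (Fin (N + 1 - r)) (Fin ((d + 1) * (r + 1))) ℤ}

theorem matches_recurrenceOf_iff (hc : c ≠ 0)
    (hM : M.map (Int.cast : ℤ → ℚ) = (c : ℚ) • guessMatrix a b r d)
    (w : Fin ((d + 1) * (r + 1)) → ℤ) : Matches a (recurrenceOf b r d w) ↔ M *ᵥ w = 0 := by
  have h := matches_sum_smul_iff a b r d (fun k => (w k : ℚ))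
  refine h.trans ?_
  have hc' : (c : ℚ) ≠ 0 := by exact_mod_cast hc
  rw [← smul_eq_zero_iff_right hc', ← Matrix.smul_mulVec, ← hM, funext_iff, funext_iff]
  refine forall_congr' fun i => ?_
  rw [map_mulVec_intCast]
  simp

theorem recurrenceOf_ne_zero (hb : LinearIndependent ℚ b) {w : Fin ((d + 1) * (r + 1)) → ℤ}
    (hw : w ≠ 0) : recurrenceOf b r d w ≠ 0 := by
  intro h
  refine hw (funext fun k => ?_)
  obtain ⟨⟨t, i⟩, rfl⟩ := finProdFinEquiv.surjective k
  have hli : LinearIndependent ℚ fun j : Fin (d + 1) => b j.val := hb.comp _ Fin.val_injective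
  have := Fintype.linearIndependent_iff.1 hli _ (congrFun h i) (Fin.rev t)
  simpa using this

theorem natDegree_recurrenceOf_le (hb : ∀ j, (b j).natDegree ≤ j)
    (w : Fin ((d + 1) * (r + 1)) → ℤ) (i : Fin (r + 1)) :
    (recurrenceOf b r d w i).natDegree ≤ d :=
  Polynomial.natDegree_sum_le_of_forall_le _ _ fun j _ =>
    (Polynomial.natDegree_smul_le _ _).trans ((hb j).trans (by omega))

theorem eq_zero_of_matches (hc : c ≠ 0)
    (hM : M.map (Int.cast : ℤ → ℚ) = (c : ℚ) • guessMatrix a b r d)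
    (hb : Submodule.span ℚ (b '' Set.Iic d) = Polynomial.degreeLE ℚ (d : WithBot ℕ))
    (hker : ∀ x, M *ᵥ x = 0 → x = 0) {P : Fin (r + 1) → Polynomial ℚ}
    (hdeg : ∀ i, (P i).natDegree ≤ d) (hP : Matches a P) : P = 0 := by
  have himage : b '' Set.Iic d = Set.range fun j : Fin (d + 1) => b j.val := by
    ext x
    constructor
    · rintro ⟨j, hj, rfl⟩
      exact ⟨⟨j, Nat.lt_succ_of_le hj⟩, rfl⟩
    · rintro ⟨j, rfl⟩
      exact ⟨j.val, Nat.le_of_lt_succ j.2, rfl⟩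
  have hspan : ∀ i, ∃ e : Fin (d + 1) → ℚ, ∑ j, e j • b j.val = P i := by
    intro i
    rw [← Submodule.mem_span_range_iff_exists_fun, ← himage, hb, Polynomial.mem_degreeLE]
    exact Polynomial.natDegree_le_iff_degree_le.1 (hdeg i)
  choose e he using hspan
  let y : Fin ((d + 1) * (r + 1)) → ℚ := fun k =>
    e (finProdFinEquiv.symm k).2 (Fin.rev (finProdFinEquiv.symm k).1)
  have hPy : P = fun i : Fin (r + 1) =>
      ∑ j : Fin (d + 1), y (finProdFinEquiv (Fin.rev j, i)) • b j.val := by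
    ext1 i
    simp only [y, Equiv.symm_apply_apply, Fin.rev_rev, he]
  rw [hPy, matches_sum_smul_iff] at hP
  -- A common denominator turns the rational solution into an integer kernel vector, to which `hker`
  -- applies.
  obtain ⟨D, hD⟩ := IsLocalization.exist_integer_multiples_of_finite (nonZeroDivisors ℤ) y
  choose x hx using hD
  have hD0 : ((D : ℤ) : ℚ) ≠ 0 := by exact_mod_cast nonZeroDivisors.ne_zero D.2
  have hxy : (fun k => (x k : ℚ)) = ((D : ℤ) : ℚ) • y := by
    ext k
    have := hx k
    simpa [Algebra.smul_def] using this
  have hx0 : x = 0 := by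
    refine hker x ((matches_recurrenceOf_iff hc hM x).1 ?_)
    have h := matches_sum_smul_iff a b r d (fun k => (x k : ℚ))
    refine h.2 ?_
    rw [hxy, Matrix.mulVec_smul, hP, smul_zero]
  have hy0 : y = 0 := by
    rw [← smul_eq_zero_iff_right hD0, ← hxy, hx0]
    ext; simp
  rw [hPy, hy0]
  ext1 i
  simp

end

/-! ### Long vectors modulo large integers -/

theorem abs_le_len {n : ℕ} (v : Fin n → ℤ) (i : Fin n) : |(v i : ℝ)| ≤ len v := by
  have := PiLp.norm_apply_le (toEuc v) i
  simpa [toEuc, len] using this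

theorem exists_abs_mulVec_le {l n : ℕ} (M : Matrix (Fin l) (Fin n) ℤ) :
    ∃ C : ℝ, 0 < C ∧ ∀ w i, |(((M *ᵥ w) i : ℤ) : ℝ)| ≤ C * len w := by
  -- The summand 1 keeps the constant positive even for a zero matrix.
  refine ⟨∑ i, ∑ j, |(M i j : ℝ)| + 1, by positivity, fun w i => ?_⟩
  have hw : 0 ≤ len w := norm_nonneg _
  calc |(((M *ᵥ w) i : ℤ) : ℝ)| = |∑ j, (M i j : ℝ) * (w j : ℝ)| := by
        simp [Matrix.mulVec, dotProduct]
    _ ≤ ∑ j, |(M i j : ℝ) * (w j : ℝ)| := Finset.abs_sum_le_sum_abs _ _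
    _ ≤ ∑ j, |(M i j : ℝ)| * len w := by
        refine Finset.sum_le_sum fun j _ => ?_
        rw [abs_mul]
        gcongr
        exact abs_le_len w j
    _ = (∑ j, |(M i j : ℝ)|) * len w := by rw [Finset.sum_mul]
    _ ≤ (∑ i, ∑ j, |(M i j : ℝ)| + 1) * len w := by
        gcongr
        have : ∑ j, |(M i j : ℝ)| ≤ ∑ i, ∑ j, |(M i j : ℝ)| :=
          Finset.single_le_sum (f := fun i => ∑ j, |(M i j : ℝ)|)
            (fun i _ => Finset.sum_nonneg fun j _ => abs_nonneg _) (Finset.mem_univ i)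
        linarith

/-- A vector in the kernel modulo a large integer `q` is long unless it is in the integer
kernel. -/
theorem exists_lt_len {l n : ℕ} (M : Matrix (Fin l) (Fin n) ℤ) (R : ℝ) :
    ∃ Q : ℕ, ∀ q : ℕ, Q ≤ q → ∀ w, (∀ i, (q : ℤ) ∣ (M *ᵥ w) i) → M *ᵥ w ≠ 0 → R < len w := by
  obtain ⟨C, hC, hCw⟩ := exists_abs_mulVec_le M
  obtain ⟨Q, hQ⟩ := exists_nat_gt (C * R)
  refine ⟨Q, fun q hq w hdvd hne => ?_⟩
  obtain ⟨i, hi⟩ := Function.ne_iff.1 hne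
  have h1 : (q : ℤ) ≤ |(M *ᵥ w) i| := Int.le_of_dvd (abs_pos.2 hi) ((dvd_abs _ _).2 (hdvd i))
  have h2 : (q : ℝ) ≤ |(((M *ᵥ w) i : ℤ) : ℝ)| := by exact_mod_cast h1
  have h3 : (Q : ℝ) ≤ q := by exact_mod_cast hq
  exact lt_of_mul_lt_mul_left (hQ.trans_le (h3.trans (h2.trans (hCw w i)))) hC.le

/-! ### Runs of the algorithm: progress, termination and correctness of results -/

section Algorithm

variable {l n p₀ : ℕ} {M : Matrix (Fin l) (Fin n) ℤ} {good : (Fin n → ℤ) → Prop}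

theorem Reachable.mem_lattice_iff (hp₀ : p₀.Prime) {q m : ℕ} {V : Fin m → Fin n → ZMod q}
    (h : Reachable (Step M good p₀) (State.merged q V)) (w : Fin n → ℤ) :
    w ∈ lattice V ↔ ∀ i, (q : ℤ) ∣ (M *ᵥ w) i := by
  obtain ⟨hq, hV⟩ := Reachable.invariant hp₀ h
  have : NeZero q := ⟨hq⟩
  exact Guess.mem_lattice_iff hV w

theorem Reachable.mem_lattice_of_mulVec_eq_zero (hp₀ : p₀.Prime) {q m : ℕ}
    {V : Fin m → Fin n → ZMod q} (h : Reachable (Step M good p₀) (State.merged q V))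
    {x : Fin n → ℤ} (hx : M *ᵥ x = 0) : x ∈ lattice V :=
  (h.mem_lattice_iff hp₀ x).2 fun i => by simp [hx]

/-- Beyond `Q`, lattice vectors outside the kernel exceed the LLL bound obtained from `x`. The bound
`Q` is chosen before the primes and bases, so it serves all runs. -/
theorem exists_modulus_bound (M : Matrix (Fin l) (Fin n) ℤ) (good : (Fin n → ℤ) → Prop)
    {x : Fin n → ℤ} (hx0 : x ≠ 0) (hx : M *ᵥ x = 0) :
    ∃ Q : ℕ, ∀ p₀ : ℕ, p₀.Prime → ∀ (q m : ℕ) (V : Fin m → Fin n → ZMod q),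
      Reachable (Step M good p₀) (State.merged q V) → Q ≤ q →
        (∀ w ∈ lattice V, M *ᵥ w ≠ 0 → 2 ^ n * len x < len w) ∧
          ∀ w, IsLLLFirst (lattice V) w → M *ᵥ w = 0 := by
  obtain ⟨Q, hQ⟩ := exists_lt_len M (2 ^ n * len x)
  refine ⟨Q, fun p₀ hp₀ q m V hV hq => ?_⟩
  have hlong : ∀ w ∈ lattice V, M *ᵥ w ≠ 0 → 2 ^ n * len x < len w := fun w hw hne =>
    hQ q hq w ((hV.mem_lattice_iff hp₀ w).1 hw) hne
  refine ⟨hlong, fun w hw => ?_⟩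
  by_contra hne
  exact absurd (hlong w hw.mem hne)
    (not_lt.2 (hw.len_le (hV.mem_lattice_of_mulVec_eq_zero hp₀ hx) hx0))

theorem lattice_ne_bot {q m n : ℕ} (hq : q ≠ 0) (hn : n ≠ 0) (V : Fin m → Fin n → ZMod q) :
    lattice V ≠ ⊥ := by
  have : NeZero n := ⟨hn⟩
  intro h
  have hmem : (Pi.single 0 (q : ℤ) : Fin n → ℤ) ∈ lattice V :=
    Submodule.subset_span (Or.inr ⟨0, rfl⟩)
  rw [h, Submodule.mem_bot] at hmem
  simp [hq] at hmem

theorem exists_prime_coprime {q : ℕ} (hq : q ≠ 0) : ∃ p, p.Prime ∧ q.Coprime p := by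
  obtain ⟨p, hle, hp⟩ := Nat.exists_infinite_primes (q + 1)
  exact ⟨p, hp, (Nat.coprime_of_lt_prime hq hle hp).symm⟩

/-- No run of the algorithm gets stuck. -/
theorem Reachable.progress (hp₀ : p₀.Prime) (hn : n ≠ 0) {s : State n}
    (h : Reachable (Step M good p₀) s) :
    (∃ result, s = State.done result) ∨ ∃ s', Step M good p₀ s s' := by
  have hinv := Reachable.invariant hp₀ h
  cases s with
  | start =>
    obtain ⟨m, V, hV⟩ := exists_isRowReducedKerBasis M hp₀
    by_cases hm : m = 0
    · subst hm
      exact Or.inr ⟨_, Step.fail V hV⟩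
    · exact Or.inr ⟨_, Step.enter hm V hV⟩
  | loop q V =>
    obtain ⟨p, hp, hqp⟩ := exists_prime_coprime hinv.1
    obtain ⟨k, W, hW⟩ := exists_isRowReducedKerBasis M hp
    exact Or.inr ⟨_, Step.newPrime V hp hqp W hW⟩
  | merged q V =>
    obtain ⟨w, hw⟩ := exists_isLLLFirst (lattice_ne_bot hinv.1 hn V)
    by_cases hg : good w
    · exact Or.inr ⟨_, Step.success V w hw hg⟩
    · exact Or.inr ⟨_, Step.again V w hw hg⟩
  | done result => exact Or.inl ⟨result, rfl⟩

theorem not_step_done {result : Option (Fin n → ℤ)} {t : State n} :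
    ¬ Step M good p₀ (State.done result) t := nofun

/-- In an infinite run, every second state is at the beginning of the loop body, with larger and
larger moduli. -/
theorem exists_loop_of_infinite_run (hp₀ : p₀.Prime) {s : ℕ → State n} (h0 : s 0 = State.start)
    (hs : ∀ k, Step M good p₀ (s k) (s (k + 1))) (k : ℕ) :
    ∃ (q m : ℕ) (V : Fin m → Fin n → ZMod q), s (2 * k + 1) = State.loop q V ∧ 2 ^ k ≤ q := by
  induction k with
  | zero =>
    have h := hs 0
    have h' := hs 1
    rw [h0] at h
    generalize hs1 : s (0 + 1) = t at h
    cases h with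
    | fail V hV =>
      rw [show s 1 = State.done none from hs1] at h'
      exact absurd h' not_step_done
    | enter hm V hV => exact ⟨p₀, _, V, rfl, hp₀.one_lt.le⟩
  | succ k ih =>
    obtain ⟨q, m, V, hV, hq⟩ := ih
    have h := hs (2 * k + 1)
    rw [hV] at h
    generalize hs1 : s (2 * k + 1 + 1) = t at h
    cases h with
    | newPrime _ hp hqp W hW =>
      have h' := hs (2 * k + 2)
      have h'' := hs (2 * k + 3)
      rw [show s (2 * k + 2) = _ from hs1] at h'
      generalize hs2 : s (2 * k + 2 + 1) = t at h'
      cases h' with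
      | success _ w hw hg =>
        rw [show s (2 * k + 3) = _ from hs2] at h''
        exact absurd h'' not_step_done
      | again _ w hw hg =>
        refine ⟨_, _, _, rfl, ?_⟩
        rw [pow_succ]
        exact Nat.mul_le_mul hq hp.two_le

theorem reachable_of_run {s : ℕ → State n} (h0 : s 0 = State.start)
    (hs : ∀ k, Step M good p₀ (s k) (s (k + 1))) (k : ℕ) : Reachable (Step M good p₀) (s k) := by
  induction k with
  | zero => rw [h0]; exact Relation.ReflTransGen.refl
  | succ k ih => exact Relation.ReflTransGen.tail ih (hs k)

/-- The loop is entered only with a nonempty basis, hence a nontrivial kernel modulo `p₀`; as `p₀`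
is not unlucky, the integer kernel is nontrivial too. -/
theorem exists_ne_zero_of_step_start (hp₀ : ¬ Unlucky M p₀) (hprime : p₀.Prime) {q m : ℕ}
    {V : Fin m → Fin n → ZMod q} (h : Step M good p₀ State.start (State.loop q V)) :
    ∃ x : Fin n → ℤ, x ≠ 0 ∧ M *ᵥ x = 0 := by
  have := Fact.mk hprime
  by_contra! hno
  cases h with
  | enter hm _ hV =>
    refine hp₀ ⟨fun x hx => by_contra fun hx0 => hno x hx0 hx, fun hbot => ?_⟩
    have hmem : V ⟨0, Nat.pos_of_ne_zero hm⟩ ∈ kerMod M p₀ :=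
      hV.span_eq ▸ Submodule.subset_span ⟨_, rfl⟩
    rw [hbot, Submodule.mem_bot] at hmem
    exact hV.linearIndependent.ne_zero _ hmem

theorem terminates (hgood : ∀ w, M *ᵥ w = 0 → good w) (hp₀ : p₀.Prime) (hlucky : ¬ Unlucky M p₀)
    (hn : n ≠ 0) : Terminates (Step M good p₀) := by
  refine ⟨?_, fun s hs => hs.progress hp₀ hn⟩
  rintro ⟨s, h0, hs⟩
  obtain ⟨x, hx0, hx⟩ : ∃ x : Fin n → ℤ, x ≠ 0 ∧ M *ᵥ x = 0 := by
    obtain ⟨q, m, V, hV, -⟩ := exists_loop_of_infinite_run hp₀ h0 hs 0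
    have h := hs 0
    rw [h0, show s (0 + 1) = _ from hV] at h
    exact exists_ne_zero_of_step_start hlucky hp₀ h
  obtain ⟨Q, hQ⟩ := exists_modulus_bound M good hx0 hx
  -- After `Q` passes the modulus is at least `2 ^ Q > Q`, so the next LLL call must return a kernel
  -- vector and the loop exits.
  obtain ⟨q, m, V, hV, hq⟩ := exists_loop_of_infinite_run hp₀ h0 hs Q
  have h := hs (2 * Q + 1)
  rw [hV] at h
  have hreach := reachable_of_run h0 hs (2 * Q + 1 + 1)
  have h' := hs (2 * Q + 2)
  have h'' := hs (2 * Q + 3)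
  generalize hs1 : s (2 * Q + 1 + 1) = t at h hreach
  cases h with
  | newPrime _ hp hqp W hW =>
    have hle := (Nat.lt_two_pow_self (n := Q)).le.trans
      (hq.trans (Nat.le_mul_of_pos_right q hp.pos))
    rw [show s (2 * Q + 2) = _ from hs1] at h'
    generalize hs2 : s (2 * Q + 2 + 1) = t at h'
    cases h' with
    | success _ w hw hg =>
      rw [show s (2 * Q + 3) = _ from hs2] at h''
      exact not_step_done h''
    | again _ w hw hg => exact hg (hgood w ((hQ p₀ hp₀ _ _ _ hreach hle).2 w hw))

theorem reachable_done_some (hp₀ : p₀.Prime) {w : Fin n → ℤ}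
    (h : Reachable (Step M good p₀) (State.done (some w))) :
    w ≠ 0 ∧ good w ∧ ∀ x, x ≠ 0 → M *ᵥ x = 0 → len w ≤ 2 ^ n * len x := by
  rcases Relation.ReflTransGen.cases_tail h with h | ⟨t, ht, hstep⟩
  · cases h
  · cases hstep with
    | success V _ hw hg =>
      exact ⟨hw.ne_zero, hg, fun x hx0 hx =>
        hw.len_le (Reachable.mem_lattice_of_mulVec_eq_zero hp₀ ht hx) hx0⟩

theorem reachable_done_none (hp₀ : p₀.Prime)
    (h : Reachable (Step M good p₀) (State.done none)) (x : Fin n → ℤ) (hx : M *ᵥ x = 0) :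
    x = 0 := by
  rcases Relation.ReflTransGen.cases_tail h with h | ⟨t, ht, hstep⟩
  · cases h
  · cases hstep with
    | fail V hV =>
      refine eq_zero_of_kerMod_eq_bot hp₀ ?_ x hx
      rw [← hV.span_eq, Set.range_eq_empty, Submodule.span_empty]

end Algorithm

end Guess

theorem mainTheorem1 {N : ℕ} (a : Fin (N + 1) → ℚ)
    (b : Module.Basis ℕ ℚ (Polynomial ℚ))
    (hb : ∀ j : ℕ, Submodule.span ℚ (b '' Set.Iic j) = Polynomial.degreeLE ℚ (j : WithBot ℕ))
    (r d : ℕ)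
    -- `M` is the matrix of the linear system, with denominators cleared
    (c : ℤ) (hc : c ≠ 0)
    (M : Matrix (Fin (N + 1 - r)) (Fin ((d + 1) * (r + 1))) ℤ)
    (hM : M.map (Int.cast : ℤ → ℚ) = (c : ℚ) • Guess.guessMatrix a b r d) :
    -- correctness: whatever primes are chosen, every result is correct
    (∀ p₀ : ℕ, p₀.Prime → ∀ result,
      Guess.Reachable (Guess.AlgStep a b r d M p₀) (Guess.State.done result) →
        Guess.Correct a b r d result) ∧
    -- termination, unless the first prime is one of finitely many unlucky primes
    {p : ℕ | p.Prime ∧ Guess.Unlucky M p}.Finite ∧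
    (∀ p₀ : ℕ, p₀.Prime → ¬ Guess.Unlucky M p₀ →
      Guess.Terminates (Guess.AlgStep a b r d M p₀)) ∧
    -- the lattice to which LLL is applied consists of the vectors in the kernel modulo `q`
    (∀ p₀ : ℕ, p₀.Prime → ∀ (q m : ℕ) (V : Fin m → Fin ((d + 1) * (r + 1)) → ZMod q),
      Guess.Reachable (Guess.AlgStep a b r d M p₀) (Guess.State.merged q V) →
        ∀ w, w ∈ Guess.lattice V ↔ ∀ i, (q : ℤ) ∣ M.mulVec w i) ∧
    -- for large `q`, the lattice vectors outside the integer kernel are long, and LLL returns an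
    -- element of the integer kernel
    (∀ x : Fin ((d + 1) * (r + 1)) → ℤ, x ≠ 0 → M.mulVec x = 0 → ∃ Q : ℕ,
      ∀ p₀ : ℕ, p₀.Prime → ∀ (q m : ℕ) (V : Fin m → Fin ((d + 1) * (r + 1)) → ZMod q),
        Guess.Reachable (Guess.AlgStep a b r d M p₀) (Guess.State.merged q V) → Q ≤ q →
          (∀ w ∈ Guess.lattice V, M.mulVec w ≠ 0 →
            2 ^ ((r + 1) * (d + 1)) * Guess.len x < Guess.len w) ∧
          ∀ w, Guess.IsLLLFirst (Guess.lattice V) w → M.mulVec w = 0) := by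
  have hgood := Guess.matches_recurrenceOf_iff hc hM
  have hdeg : ∀ j, (b j).natDegree ≤ j := by
    intro j
    have : b j ∈ Polynomial.degreeLE ℚ (j : WithBot ℕ) :=
      hb j ▸ Submodule.subset_span ⟨j, Set.mem_Iic.2 le_rfl, rfl⟩
    exact Polynomial.natDegree_le_iff_degree_le.2 (Polynomial.mem_degreeLE.1 this)
  refine ⟨?_, Guess.finite_unlucky M, ?_, ?_, ?_⟩
  · intro p₀ hp₀ result hres
    cases result with
    | none =>
      exact fun P hPdeg hP => Guess.eq_zero_of_matches hc hM (hb d)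
        (Guess.reachable_done_none hp₀ hres) hPdeg hP
    | some w =>
      obtain ⟨hw0, hw, hlen⟩ := Guess.reachable_done_some hp₀ hres
      refine ⟨Guess.recurrenceOf_ne_zero b.linearIndependent hw0,
        Guess.natDegree_recurrenceOf_le hdeg w, hw, fun x hx0 hx => ?_⟩
      rw [mul_comm (r + 1)]
      exact hlen x hx0 ((hgood x).1 hx)
  · intro p₀ hp₀ hlucky
    -- The number of columns must be positive: otherwise the lattice is zero and has no first
    -- vector.
    exact Guess.terminates (fun w hw => (hgood w).2 hw) hp₀ hlucky (by positivity)
  · intro p₀ hp₀ q m V hV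
    exact Guess.Reachable.mem_lattice_iff hp₀ hV
  · intro x hx0 hx
    rw [mul_comm (r + 1)]
    exact Guess.exists_modulus_bound M _ hx0 hx
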